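/- Let $n>1$ be an integer, and let $\mathcal{G}(\mathbb{Z}_n)$ be the power graph of the additive group $\mathbb{Z}_n$ of integers modulo $n$: the simple graph with vertex set $\mathbb{Z}_n$ in which two distinct vertices $u$ and $v$ are adjacent if and only if $v=\alpha u$ or $u=\alpha v$ for some positive integer $\alpha$. Let $\kappa(\mathcal{G}(\mathbb{Z}_n))$ be its vertex connectivity, that is, the minimum number of vertices whose removal leaves a disconnected graph or a graph with exactly one vertex. Let $\lambda_{n-1}(\mathcal{G}(\mathbb{Z}_n))$ be its algebraic connectivity, that is, the second smallest eigenvalue of its Laplacian matrix $L=D-A$, where $D$ is the diagonal matrix of vertex degrees, $A$ is the adjacency matrix, and the eigenvalues $\lambda_1\ge\lambda_2\ge\dots\ge\lambda_n=0$ of $L$ are listed with multiplicity. Then $$\kappa(\mathcal{G}(\mathbb{Z}_n))=\lambda_{n-1}(\mathcal{G}(\mathbb{Z}_n))$$ if and only if $n=pq$ for two distinct primes $p$ and $q$. -/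

import Mathlib

/-- The power graph of a monoid: distinct `u`, `v` are adjacent when one of them is a
positive power of the other. -/
def powerGraph (M : Type*) [Monoid M] : SimpleGraph M :=
  SimpleGraph.fromRel fun u v => ∃ a : ℕ, 0 < a ∧ v = u ^ a

/-- The vertex connectivity `κ(Γ)`: the least number of vertices whose removal leaves a
disconnected graph or a graph with exactly one vertex. -/
noncomputable def vertexConnectivity {V : Type*} (Γ : SimpleGraph V) : ℕ :=
  sInf {k : ℕ | ∃ S : Finset V, S.card = k ∧
    (¬ (Γ.induce ((S : Set V)ᶜ)).Preconnected ∨ ((S : Set V)ᶜ).ncard = 1)}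

open Classical in
/-- The Laplacian eigenvalue `λ_i(Γ)`, for `1 ≤ i ≤ |V|`, where the eigenvalues of the Laplacian
matrix are listed with multiplicity in non-increasing order `λ_1 ≥ λ_2 ≥ ... ≥ λ_{|V|}`.
The value is `0` when `i` is out of range. -/
noncomputable def laplacianEigenvalue {V : Type*} [Fintype V] (Γ : SimpleGraph V) (i : ℕ) : ℝ :=
  if h : 1 ≤ i ∧ i ≤ Fintype.card V then
    (Γ.isHermitian_lapMatrix (R := ℝ)).eigenvalues₀ ⟨i - 1, by omega⟩
  else 0

/-- The algebraic connectivity of a graph with `m` vertices: its Laplacian eigenvalue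
`λ_{m-1}`. -/
noncomputable def algebraicConnectivity {V : Type*} [Fintype V] (Γ : SimpleGraph V) : ℝ :=
  laplacianEigenvalue Γ (Fintype.card V - 1)

/-! Two bounds pin the algebraic connectivity `λ`. For a cut `S`, a vector that vanishes on `S`, is
constant on each side and sums to zero has Rayleigh quotient at most `|S|`; equality forces every
vertex of `S` to be adjacent to every vertex outside (`algebraicConnectivity_le_card`). Conversely,
`λ` is at least the number of dominating vertices (`card_le_algebraicConnectivity`). So `κ = λ`
makes the graph a join over a minimum cut, and a cut made of dominating vertices gives `κ ≤ |D| ≤ λ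
≤ κ`.

In a finite cyclic group, adjacency is divisibility between orders. In a join, a vertex not adjacent
to one outside `S` is itself outside `S`; this spreads to all elements other than the identity and
the generators. Elements of prime orders `r`, `s` on opposite sides would be linked by one of order
`rs`, unless `rs = n`. For `n = pq`, the identity and the generators dominate, and deleting them
separates order `p` from order `q`. -/

/-! ### Rayleigh quotients and the second least eigenvalue -/

open scoped RealInnerProductSpace in
theorem LinearMap.IsSymmetric.inner_apply_self_eq_sum {E : Type*} [NormedAddCommGroup E]
    [InnerProductSpace ℝ E] [FiniteDimensional ℝ E] {T : E →ₗ[ℝ] E} (hT : T.IsSymmetric) {n : ℕ}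
    (hn : Module.finrank ℝ E = n) (x : E) :
    ⟪T x, x⟫ = ∑ i, hT.eigenvalues hn i * ⟪hT.eigenvectorBasis hn i, x⟫ ^ 2 := by
  rw [← (hT.eigenvectorBasis hn).sum_inner_mul_inner]
  refine Finset.sum_congr rfl fun i _ => ?_
  rw [hT x, hT.apply_eigenvectorBasis hn i]
  simp only [RCLike.ofReal_real_eq_id, id_eq, inner_smul_right, real_inner_comm]
  ring

open scoped RealInnerProductSpace in
/-- A form bound for vectors orthogonal to the eigenvector of the least eigenvalue. -/
theorem LinearMap.IsSymmetric.eigenvalues_mul_norm_sq_le {E : Type*} [NormedAddCommGroup E]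
    [InnerProductSpace ℝ E] [FiniteDimensional ℝ E] {T : E →ₗ[ℝ] E} (hT : T.IsSymmetric) {n : ℕ}
    (hn : Module.finrank ℝ E = n) {i₀ i₁ : Fin n} (h₀ : (i₀ : ℕ) + 1 = n)
    (h₁ : (i₁ : ℕ) + 2 = n) {x : E} (hx : ⟪hT.eigenvectorBasis hn i₀, x⟫ = 0) :
    hT.eigenvalues hn i₁ * ‖x‖ ^ 2 ≤ ⟪T x, x⟫ := by
  rw [hT.inner_apply_self_eq_sum hn, ← (hT.eigenvectorBasis hn).sum_sq_inner_right,
    Finset.mul_sum]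
  refine Finset.sum_le_sum fun i _ => ?_
  by_cases hi : i = i₀
  · simp [hi, hx]
  · have hne : (i : ℕ) ≠ i₀ := fun h => hi (Fin.ext h)
    have hle : i ≤ i₁ := by
      rw [Fin.le_def]
      omega
    exact mul_le_mul_of_nonneg_right (hT.eigenvalues_antitone hn hle) (sq_nonneg _)

open scoped RealInnerProductSpace in
/-- The second least eigenvalue of a symmetric operator is a lower bound of the Rayleigh quotient
at a vector orthogonal to a kernel vector, as soon as the quotient is nonnegative. -/
theorem LinearMap.IsSymmetric.eigenvalues_mul_norm_sq_le_of_inner_eq_zero {E : Type*}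
    [NormedAddCommGroup E] [InnerProductSpace ℝ E] [FiniteDimensional ℝ E] {T : E →ₗ[ℝ] E}
    (hT : T.IsSymmetric) {n : ℕ} (hn : Module.finrank ℝ E = n) {i₀ i₁ : Fin n}
    (h₀ : (i₀ : ℕ) + 1 = n) (h₁ : (i₁ : ℕ) + 2 = n) {u x : E} (hu : u ≠ 0) (hTu : T u = 0)
    (hux : ⟪u, x⟫ = 0) (hx : 0 ≤ ⟪T x, x⟫) :
    hT.eigenvalues hn i₁ * ‖x‖ ^ 2 ≤ ⟪T x, x⟫ := by
  set b := hT.eigenvectorBasis hn with hb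
  rcases le_or_gt (hT.eigenvalues hn i₁) 0 with hl | hl
  · exact (mul_nonpos_of_nonpos_of_nonneg hl (sq_nonneg _)).trans hx
  by_cases hbx : ⟪b i₀, x⟫ = 0
  · exact hT.eigenvalues_mul_norm_sq_le hn h₀ h₁ hbx
  have hxu : ⟪x, u⟫ = 0 := by rw [real_inner_comm, hux]
  -- This combination of `x` and `u` is orthogonal to `b i₀`, and since `T u = 0` its form value is
  -- that of `x` times `⟪b i₀, u⟫ ^ 2`.
  have key := hT.eigenvalues_mul_norm_sq_le hn h₀ h₁
    (x := ⟪b i₀, u⟫ • x - ⟪b i₀, x⟫ • u) (by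
      rw [← hb, inner_sub_right, inner_smul_right, inner_smul_right]; ring)
  have hTxu : ⟪T x, u⟫ = 0 := by rw [hT x u, hTu, inner_zero_right]
  rw [← real_inner_self_eq_norm_sq] at key ⊢
  simp only [map_sub, map_smul, hTu, smul_zero, sub_zero, inner_sub_left, inner_sub_right,
    real_inner_smul_left, real_inner_smul_right, hux, hxu, hTxu, mul_zero, zero_sub,
    sub_neg_eq_add] at key
  have hu' : 0 < ⟪u, u⟫ := real_inner_self_pos.mpr hu
  have hp : 0 < ⟪b i₀, x⟫ ^ 2 * ⟪u, u⟫ := by positivity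
  have hq : 0 < hT.eigenvalues hn i₁ * (⟪b i₀, x⟫ ^ 2 * ⟪u, u⟫) := mul_pos hl hp
  by_cases hbu : ⟪b i₀, u⟫ = 0
  · rw [hbu] at key
    nlinarith
  · have hs : 0 < ⟪b i₀, u⟫ ^ 2 := by positivity
    refine le_of_mul_le_mul_left ?_ hs
    nlinarith

open scoped RealInnerProductSpace in
/-- A lower bound of the Rayleigh quotient on a hyperplane bounds the second least eigenvalue. -/
theorem LinearMap.IsSymmetric.le_eigenvalues_of_forall_inner_eq_zero {E : Type*}
    [NormedAddCommGroup E] [InnerProductSpace ℝ E] [FiniteDimensional ℝ E] {T : E →ₗ[ℝ] E}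
    (hT : T.IsSymmetric) {n : ℕ} (hn : Module.finrank ℝ E = n) {i₀ i₁ : Fin n}
    (h₀ : (i₀ : ℕ) + 1 = n) (h₁ : (i₁ : ℕ) + 2 = n) {u : E} {c : ℝ}
    (hc : ∀ x, ⟪u, x⟫ = 0 → c * ‖x‖ ^ 2 ≤ ⟪T x, x⟫) :
    c ≤ hT.eigenvalues hn i₁ := by
  set b := hT.eigenvectorBasis hn with hb
  have hT' : ∀ i, T (b i) = hT.eigenvalues hn i • b i := fun i =>
    hT.apply_eigenvectorBasis hn i
  have hle : hT.eigenvalues hn i₀ ≤ hT.eigenvalues hn i₁ :=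
    hT.eigenvalues_antitone hn (by rw [Fin.le_def]; omega)
  have hne : i₀ ≠ i₁ := by
    rintro rfl
    omega
  have hort : ∀ i j, ⟪b i, b j⟫ = if i = j then 1 else 0 :=
    orthonormal_iff_ite.mp b.orthonormal
  by_cases hu : ⟪u, b i₁⟫ = 0
  · have := hc _ hu
    simpa [hT', inner_smul_left, hort, ← real_inner_self_eq_norm_sq] using this
  -- The Rayleigh quotient here is a weighted mean of the two least eigenvalues, hence at most the
  -- larger one.
  · have key := hc (⟪u, b i₁⟫ • b i₀ - ⟪u, b i₀⟫ • b i₁) (by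
      rw [inner_sub_right, inner_smul_right, inner_smul_right]; ring)
    rw [← real_inner_self_eq_norm_sq] at key
    simp only [map_sub, map_smul, hT', inner_sub_left, inner_sub_right, real_inner_smul_left,
      real_inner_smul_right, hort, hne, hne.symm, if_true, if_false] at key
    have hs : 0 < ⟪u, b i₁⟫ ^ 2 + ⟪u, b i₀⟫ ^ 2 := by positivity
    refine le_of_mul_le_mul_right ?_ hs
    nlinarith [mul_le_mul_of_nonneg_left hle (sq_nonneg ⟪u, b i₁⟫)]

/-! ### The Laplacian form and bounds on the algebraic connectivity -/

open Classical in
/-- The Laplacian quadratic form, each edge counted once in each direction. -/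
noncomputable def laplacianForm {V : Type*} [Fintype V] (Γ : SimpleGraph V) (x : V → ℝ) : ℝ :=
  ∑ i, ∑ j, if Γ.Adj i j then (x i - x j) ^ 2 else 0

open Classical in
theorem inner_toEuclideanLin_lapMatrix {V : Type*} [Fintype V] (Γ : SimpleGraph V)
    (x : EuclideanSpace ℝ V) :
    inner ℝ ((Γ.lapMatrix ℝ).toEuclideanLin x) x = laplacianForm Γ x / 2 := by
  rw [laplacianForm, ← Γ.lapMatrix_toLinearMap₂' ℝ, Matrix.toLinearMap₂'_apply',
    PiLp.inner_apply]
  simp [dotProduct, Matrix.toLpLin_apply]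

open Classical in
theorem algebraicConnectivity_eq {V : Type*} [Fintype V] (Γ : SimpleGraph V)
    (h : 2 ≤ Fintype.card V) :
    algebraicConnectivity Γ = (Matrix.isSymmetric_toEuclideanLin_iff.mpr
      (Γ.isHermitian_lapMatrix (R := ℝ))).eigenvalues finrank_euclideanSpace
      ⟨Fintype.card V - 2, by omega⟩ := by
  rw [algebraicConnectivity, laplacianEigenvalue, dif_pos ⟨by omega, by omega⟩]
  rfl

theorem algebraicConnectivity_mul_le {V : Type*} [Fintype V] (Γ : SimpleGraph V)
    (h : 2 ≤ Fintype.card V) (x : V → ℝ) (hx : ∑ i, x i = 0) :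
    2 * algebraicConnectivity Γ * ∑ i, x i ^ 2 ≤ laplacianForm Γ x := by
  classical
  have hn : 0 < Fintype.card V := by omega
  have : Nonempty V := Fintype.card_pos_iff.mp hn
  rw [algebraicConnectivity_eq Γ h]
  have key := (Matrix.isSymmetric_toEuclideanLin_iff.mpr
      (Γ.isHermitian_lapMatrix (R := ℝ))).eigenvalues_mul_norm_sq_le_of_inner_eq_zero
      finrank_euclideanSpace (i₀ := ⟨Fintype.card V - 1, by omega⟩)
      (i₁ := ⟨Fintype.card V - 2, by omega⟩) (by simp; omega) (by simp; omega)
      (u := WithLp.toLp 2 fun _ => (1 : ℝ)) (x := WithLp.toLp 2 x)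
      (fun h0 => by
        have := congrArg (fun v : EuclideanSpace ℝ V => v (Classical.arbitrary V)) h0
        simp at this)
      (by
        rw [Matrix.toLpLin_apply]
        simp [SimpleGraph.lapMatrix_mulVec_const_eq_zero])
      (by simpa [PiLp.inner_apply] using hx)
      (by
        rw [inner_toEuclideanLin_lapMatrix]
        refine div_nonneg (Finset.sum_nonneg fun i _ => Finset.sum_nonneg fun j _ => ?_) (by simp)
        split_ifs <;> positivity)
  rw [inner_toEuclideanLin_lapMatrix, EuclideanSpace.norm_sq_eq] at key
  simp only [Real.norm_eq_abs, sq_abs] at key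
  linarith

theorem le_algebraicConnectivity {V : Type*} [Fintype V] (Γ : SimpleGraph V)
    (h : 2 ≤ Fintype.card V) {c : ℝ}
    (hc : ∀ x : V → ℝ, ∑ i, x i = 0 → 2 * c * ∑ i, x i ^ 2 ≤ laplacianForm Γ x) :
    c ≤ algebraicConnectivity Γ := by
  classical
  rw [algebraicConnectivity_eq Γ h]
  refine LinearMap.IsSymmetric.le_eigenvalues_of_forall_inner_eq_zero _ _
    (i₀ := ⟨Fintype.card V - 1, by omega⟩) (by simp; omega) (by simp; omega)
    (u := WithLp.toLp 2 fun _ => (1 : ℝ)) fun x hx => ?_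
  have := hc x (by simpa [PiLp.inner_apply] using hx)
  rw [inner_toEuclideanLin_lapMatrix, EuclideanSpace.norm_sq_eq]
  simp only [Real.norm_eq_abs, sq_abs]
  linarith

/-- The number of dominating vertices is at most the algebraic connectivity. -/
theorem card_le_algebraicConnectivity {V : Type*} [Fintype V] (Γ : SimpleGraph V)
    (h : 2 ≤ Fintype.card V) (D : Finset V) (hD : ∀ d ∈ D, ∀ v, d ≠ v → Γ.Adj d v) :
    (D.card : ℝ) ≤ algebraicConnectivity Γ := by
  classical
  refine le_algebraicConnectivity Γ h fun x hx => ?_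
  -- Inclusion–exclusion over pairs meeting `D`, all of which are edges; the remaining edges
  -- contribute nonnegative terms and are dropped.
  have h1 : ∀ i j, (if i ∈ D then (x i - x j) ^ 2 else 0) + (if j ∈ D then (x i - x j) ^ 2 else 0)
      - (if i ∈ D then if j ∈ D then (x i - x j) ^ 2 else 0 else 0)
      ≤ if Γ.Adj i j then (x i - x j) ^ 2 else 0 := by
    intro i j
    by_cases hij : i = j
    · simp [hij]
    by_cases hi : i ∈ D
    · rw [if_pos (hD i hi j hij)]
      split_ifs <;> simp
    · by_cases hj : j ∈ D
      · rw [if_pos (hD j hj i (Ne.symm hij)).symm]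
        simp [hi, hj]
      · simp only [hi, hj, if_false]
        split_ifs <;> simp [sq_nonneg]
  have hsum : ∀ a : ℝ, ∑ j, (a - x j) ^ 2 = Fintype.card V * a ^ 2 + ∑ j, x j ^ 2 := by
    intro a
    simp only [sub_sq, Finset.sum_add_distrib, Finset.sum_sub_distrib, ← Finset.mul_sum, hx]
    simp
  have hsumD : ∀ a : ℝ, ∑ j ∈ D, (a - x j) ^ 2 =
      D.card * a ^ 2 - 2 * a * ∑ j ∈ D, x j + ∑ j ∈ D, x j ^ 2 := by
    intro a
    simp only [sub_sq, Finset.sum_add_distrib, Finset.sum_sub_distrib, ← Finset.mul_sum]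
    simp
  have e1 : ∑ i, ∑ j, (if i ∈ D then (x i - x j) ^ 2 else 0) =
      Fintype.card V * ∑ i ∈ D, x i ^ 2 + D.card * ∑ j, x j ^ 2 := by
    rw [← Finset.sum_filter_add_sum_filter_not Finset.univ (· ∈ D)]
    rw [Finset.sum_congr rfl (g := fun i => Fintype.card V * x i ^ 2 + ∑ j, x j ^ 2),
      Finset.sum_congr (s₁ := Finset.univ.filter (¬ · ∈ D)) rfl (g := fun _ => 0)]
    · simp [Finset.sum_add_distrib, Finset.mul_sum]
    · intro i hi
      simp [(Finset.mem_filter.mp hi).2]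
    · intro i hi
      simp [(Finset.mem_filter.mp hi).2, hsum]
  have e2 : ∑ i, ∑ j, (if j ∈ D then (x i - x j) ^ 2 else 0) =
      Fintype.card V * ∑ i ∈ D, x i ^ 2 + D.card * ∑ j, x j ^ 2 := by
    rw [← e1, Finset.sum_comm]
    refine Finset.sum_congr rfl fun i _ => Finset.sum_congr rfl fun j _ => ?_
    rw [sub_sq_comm]
  have e3 : ∑ i, ∑ j, (if i ∈ D then if j ∈ D then (x i - x j) ^ 2 else 0 else 0) =
      2 * D.card * ∑ i ∈ D, x i ^ 2 - 2 * (∑ i ∈ D, x i) ^ 2 := by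
    have : ∀ i, ∑ j, (if i ∈ D then if j ∈ D then (x i - x j) ^ 2 else 0 else 0) =
        if i ∈ D then ∑ j ∈ D, (x i - x j) ^ 2 else 0 := by
      intro i
      split_ifs <;> simp [Finset.sum_ite_mem]
    simp only [this, Finset.sum_ite_mem, Finset.univ_inter, hsumD, Finset.sum_add_distrib,
      Finset.sum_sub_distrib, ← Finset.mul_sum, ← Finset.sum_mul]
    simp
    ring
  have h2 := Finset.sum_le_sum fun i (_ : i ∈ Finset.univ) =>
    Finset.sum_le_sum fun j (_ : j ∈ Finset.univ) => h1 i j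
  simp only [Finset.sum_add_distrib, Finset.sum_sub_distrib, e1, e2, e3] at h2
  have hcard : (D.card : ℝ) ≤ Fintype.card V := by exact_mod_cast D.card_le_univ
  have h3 : (D.card : ℝ) * ∑ i ∈ D, x i ^ 2 ≤ Fintype.card V * ∑ i ∈ D, x i ^ 2 :=
    mul_le_mul_of_nonneg_right hcard (Finset.sum_nonneg fun _ _ => sq_nonneg _)
  have h4 := sq_nonneg (∑ i ∈ D, x i)
  unfold laplacianForm
  linarith

/-- Fiedler's inequality for a cut `S` separating `A` from the rest, with its equality case. -/
theorem algebraicConnectivity_le_card {V : Type*} [Fintype V] (Γ : SimpleGraph V)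
    (S : Finset V) (A : Set V) (hA : ∃ a ∉ S, a ∈ A) (hB : ∃ b ∉ S, b ∉ A)
    (hAB : ∀ i ∉ S, ∀ j ∉ S, Γ.Adj i j → i ∈ A → j ∈ A) :
    algebraicConnectivity Γ ≤ S.card ∧
      (algebraicConnectivity Γ = S.card → ∀ i ∈ S, ∀ j ∉ S, Γ.Adj i j) := by
  classical
  obtain ⟨a, haS, haA⟩ := hA
  obtain ⟨b, hbS, hbA⟩ := hB
  have h2 : 2 ≤ Fintype.card V :=
    Fintype.one_lt_card_iff.mpr ⟨a, b, fun h => hbA (h ▸ haA)⟩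
  set P := Finset.univ.filter fun v => v ∉ S ∧ v ∈ A with hP
  set N := Finset.univ.filter fun v => v ∉ S ∧ v ∉ A with hN
  have hPpos : 0 < (P.card : ℝ) := by
    exact_mod_cast Finset.card_pos.mpr ⟨a, by simp [hP, haS, haA]⟩
  have hNpos : 0 < (N.card : ℝ) := by
    exact_mod_cast Finset.card_pos.mpr ⟨b, by simp [hN, hbS, hbA]⟩
  -- Each side is weighted by the size of the other, so that the sum is zero.
  let x : V → ℝ := fun v => (if v ∉ S ∧ v ∈ A then (N.card : ℝ) else 0) -
    (if v ∉ S ∧ v ∉ A then (P.card : ℝ) else 0)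
  have hxS : ∀ v ∈ S, x v = 0 := fun v hv => by simp [x, hv]
  have hxA : ∀ v ∉ S, v ∈ A → x v = N.card := fun v hv hvA => by simp [x, hv, hvA]
  have hxB : ∀ v ∉ S, v ∉ A → x v = -P.card := fun v hv hvA => by simp [x, hv, hvA]
  have hxne : ∀ v ∉ S, x v ≠ 0 := fun v hv => by
    by_cases hvA : v ∈ A
    · rw [hxA v hv hvA]
      exact hNpos.ne'
    · rw [hxB v hv hvA]
      exact (neg_neg_of_pos hPpos).ne
  have hsum : ∑ v, x v = 0 := by
    simp only [x, Finset.sum_sub_distrib, ← Finset.sum_filter, Finset.sum_const, nsmul_eq_mul]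
    rw [← hP, ← hN]
    ring
  have hpos : 0 < ∑ v, x v ^ 2 :=
    Finset.sum_pos' (fun _ _ => sq_nonneg _) ⟨a, Finset.mem_univ _, by
      have := hxne a haS
      positivity⟩
  have hlow := algebraicConnectivity_mul_le Γ h2 x hsum
  have hterm : ∀ i j, (if Γ.Adj i j then (x i - x j) ^ 2 else 0) ≤
      (if i ∈ S then x j ^ 2 else 0) + (if j ∈ S then x i ^ 2 else 0) := by
    intro i j
    by_cases hadj : Γ.Adj i j
    · rw [if_pos hadj]
      by_cases hi : i ∈ S
      · by_cases hj : j ∈ S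
        · simp [hi, hj, hxS]
        · simp [hi, hj, hxS]
      · by_cases hj : j ∈ S
        · simp [hi, hj, hxS]
        · have : x i = x j := by
            by_cases hiA : i ∈ A
            · rw [hxA i hi hiA, hxA j hj (hAB i hi j hj hadj hiA)]
            · rw [hxB i hi hiA, hxB j hj fun h => hiA (hAB j hj i hi hadj.symm h)]
          simp [hi, hj, this]
    · rw [if_neg hadj]
      split_ifs <;> positivity
  have hup : ∑ i, ∑ j, ((if i ∈ S then x j ^ 2 else 0) + (if j ∈ S then x i ^ 2 else 0)) =
      2 * S.card * ∑ v, x v ^ 2 := by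
    have h1 : ∀ i, ∑ j, (if i ∈ S then x j ^ 2 else 0) =
        if i ∈ S then ∑ j, x j ^ 2 else 0 := by
      intro i
      split_ifs <;> simp
    simp only [Finset.sum_add_distrib, h1, Finset.sum_ite_mem, Finset.univ_inter,
      Finset.sum_const, nsmul_eq_mul, ← Finset.mul_sum]
    ring
  have hform : laplacianForm Γ x ≤ 2 * S.card * ∑ v, x v ^ 2 := by
    rw [← hup]
    exact Finset.sum_le_sum fun i _ => Finset.sum_le_sum fun j _ => hterm i j
  refine ⟨?_, fun heq i hi j hj => ?_⟩
  · have := le_of_mul_le_mul_right (hlow.trans hform) hpos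
    linarith
  · rw [heq] at hlow
    -- Equal totals force the termwise bound to be tight everywhere, but a missing edge from `S` to
    -- `j ∉ S` would lose `x j ^ 2 > 0`.
    have htot := (hform.antisymm hlow).trans hup.symm
    rw [laplacianForm, Finset.sum_eq_sum_iff_of_le fun i _ => Finset.sum_le_sum fun j _ => hterm i j]
      at htot
    have hrow := htot i (Finset.mem_univ _)
    rw [Finset.sum_eq_sum_iff_of_le fun j _ => hterm i j] at hrow
    have hent := hrow j (Finset.mem_univ _)
    by_contra hadj
    rw [if_neg hadj, if_pos hi, if_neg hj, add_zero] at hent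
    exact hxne j hj (pow_eq_zero_iff two_ne_zero |>.mp hent.symm)

/-! ### Separations and vertex connectivity -/

theorem exists_separation_of_not_preconnected {V : Type*} (Γ : SimpleGraph V) (S : Finset V)
    (h : ¬ (Γ.induce ((S : Set V)ᶜ)).Preconnected) :
    ∃ A : Set V, (∃ a ∉ S, a ∈ A) ∧ (∃ b ∉ S, b ∉ A) ∧
      ∀ i ∉ S, ∀ j ∉ S, Γ.Adj i j → i ∈ A → j ∈ A := by
  simp only [SimpleGraph.Preconnected, not_forall] at h
  obtain ⟨⟨a, ha⟩, ⟨b, hb⟩, hab⟩ := h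
  refine ⟨{v | ∃ hv : v ∈ ((S : Set V)ᶜ), (Γ.induce ((S : Set V)ᶜ)).Reachable ⟨a, ha⟩ ⟨v, hv⟩},
    ⟨a, by simpa using ha, ha, SimpleGraph.Reachable.refl _⟩, ⟨b, by simpa using hb, ?_⟩, ?_⟩
  · rintro ⟨_, hr⟩
    exact hab hr
  · rintro i hi j hj hadj ⟨hi', hr⟩
    refine ⟨by simpa using hj, hr.trans (SimpleGraph.Adj.reachable ?_)⟩
    simpa using hadj

theorem not_preconnected_of_separation {V : Type*} (Γ : SimpleGraph V) (S : Finset V)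
    (A : Set V) (hA : ∃ a ∉ S, a ∈ A) (hB : ∃ b ∉ S, b ∉ A)
    (hAB : ∀ i ∉ S, ∀ j ∉ S, Γ.Adj i j → i ∈ A → j ∈ A) :
    ¬ (Γ.induce ((S : Set V)ᶜ)).Preconnected := by
  obtain ⟨a, haS, haA⟩ := hA
  obtain ⟨b, hbS, hbA⟩ := hB
  intro h
  obtain ⟨w⟩ := h ⟨a, by simpa using haS⟩ ⟨b, by simpa using hbS⟩
  have aux : ∀ u v : ((S : Set V)ᶜ : Set V), (Γ.induce ((S : Set V)ᶜ)).Walk u v →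
      (u : V) ∈ A → (v : V) ∈ A := by
    intro u v w
    induction w with
    | nil => exact id
    | @cons u v _ hadj _ ih =>
      exact fun hu => ih (hAB u (fun h => u.2 h) v (fun h => v.2 h) hadj hu)
  exact hbA (aux _ _ w haA)

theorem vertexConnectivity_le {V : Type*} (Γ : SimpleGraph V) (S : Finset V)
    (h : ¬ (Γ.induce ((S : Set V)ᶜ)).Preconnected ∨ ((S : Set V)ᶜ).ncard = 1) :
    vertexConnectivity Γ ≤ S.card :=
  Nat.sInf_le ⟨S, rfl, h⟩

theorem vertexConnectivity_add_one_le {V : Type*} [Fintype V] [Nonempty V] (Γ : SimpleGraph V) :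
    vertexConnectivity Γ + 1 ≤ Fintype.card V := by
  classical
  have h := vertexConnectivity_le Γ (Finset.univ.erase (Classical.arbitrary V)) (Or.inr (by
    rw [show ((Finset.univ.erase (Classical.arbitrary V) : Finset V) : Set V)ᶜ =
      {Classical.arbitrary V} by ext; simp]
    exact Set.ncard_singleton _))
  rw [Finset.card_erase_of_mem (Finset.mem_univ _), Finset.card_univ] at h
  have := Fintype.card_pos (α := V)
  omega

/-- Deleting all vertices but two nonadjacent ones disconnects the graph. This rules out the
one-vertex alternative for a minimum cut. -/
theorem vertexConnectivity_add_two_le {V : Type*} [Fintype V] (Γ : SimpleGraph V) {u v : V}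
    (hne : u ≠ v) (huv : ¬ Γ.Adj u v) : vertexConnectivity Γ + 2 ≤ Fintype.card V := by
  classical
  have h := vertexConnectivity_le Γ ({u, v} : Finset V)ᶜ (Or.inl
    (not_preconnected_of_separation Γ _ {u} ⟨u, by simp, rfl⟩ ⟨v, by simp, by simpa using hne.symm⟩
      (by
        intro i _ j hj hadj hi
        rw [Set.mem_singleton_iff] at hi
        subst hi
        simp only [Finset.mem_compl, Finset.mem_insert, Finset.mem_singleton, not_not] at hj
        rcases hj with rfl | rfl
        · rfl
        · exact absurd hadj huv)))
  rw [Finset.card_compl, Finset.card_pair hne] at h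
  have : 2 ≤ Fintype.card V := Fintype.one_lt_card_iff.mpr ⟨u, v, hne⟩
  omega

/-- If the two connectivities agree, then the graph is the join of a nonempty separated part and
the subgraph induced by a minimum cut. -/
theorem exists_join_of_vertexConnectivity_eq {V : Type*} [Fintype V] (Γ : SimpleGraph V)
    (h : 2 ≤ Fintype.card V)
    (heq : (vertexConnectivity Γ : ℝ) = algebraicConnectivity Γ) :
    ∃ (S : Finset V) (A : Set V), (∃ a ∉ S, a ∈ A) ∧ (∃ b ∉ S, b ∉ A) ∧
      (∀ i ∉ S, ∀ j ∉ S, Γ.Adj i j → i ∈ A → j ∈ A) ∧ ∀ i ∈ S, ∀ j ∉ S, Γ.Adj i j := by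
  have hpos : 0 < Fintype.card V := by omega
  have : Nonempty V := Fintype.card_pos_iff.mp hpos
  by_cases hc : ∀ u v, u ≠ v → Γ.Adj u v
  -- In a complete graph every vertex dominates, so `λ ≥ |V| > κ`.
  · have h1 := card_le_algebraicConnectivity Γ h Finset.univ fun d _ v hd => hc d v hd
    rw [← heq, Finset.card_univ] at h1
    have h2 := vertexConnectivity_add_one_le Γ
    have h3 : Fintype.card V ≤ vertexConnectivity Γ := by exact_mod_cast h1
    omega
  · push Not at hc
    obtain ⟨u, v, hne, huv⟩ := hc
    have hle := vertexConnectivity_add_two_le Γ hne huv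
    have hmem := Nat.sInf_mem (s := {k : ℕ | ∃ S : Finset V, S.card = k ∧
      (¬ (Γ.induce ((S : Set V)ᶜ)).Preconnected ∨ ((S : Set V)ᶜ).ncard = 1)})
      (by
        by_contra hempty
        rw [Set.not_nonempty_iff_eq_empty] at hempty
        classical
        have : (Finset.univ.erase u).card ∈ (∅ : Set ℕ) := by
          rw [← hempty]
          refine ⟨_, rfl, Or.inr ?_⟩
          rw [show ((Finset.univ.erase u : Finset V) : Set V)ᶜ = {u} by ext; simp]
          exact Set.ncard_singleton _
        exact this)
    obtain ⟨S, hS, hcut | hone⟩ := hmem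
    · obtain ⟨A, hA, hB, hAB⟩ := exists_separation_of_not_preconnected Γ S hcut
      refine ⟨S, A, hA, hB, hAB, (algebraicConnectivity_le_card Γ S A hA hB hAB).2 ?_⟩
      rw [hS, ← heq]
      rfl
    · exfalso
      have hκ : S.card = vertexConnectivity Γ := hS
      classical
      rw [← Finset.coe_compl, Set.ncard_coe_finset, Finset.card_compl] at hone
      omega

/-- If removing dominating vertices disconnects the graph, then the two connectivities agree. -/
theorem vertexConnectivity_eq_of_dominating_cut {V : Type*} [Fintype V] (Γ : SimpleGraph V)
    (D : Finset V) (hD : ∀ d ∈ D, ∀ v, d ≠ v → Γ.Adj d v) (A : Set V) (hA : ∃ a ∉ D, a ∈ A)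
    (hB : ∃ b ∉ D, b ∉ A) (hAB : ∀ i ∉ D, ∀ j ∉ D, Γ.Adj i j → i ∈ A → j ∈ A) :
    (vertexConnectivity Γ : ℝ) = algebraicConnectivity Γ := by
  have h2 : 2 ≤ Fintype.card V := by
    obtain ⟨a, _, haA⟩ := hA
    obtain ⟨b, _, hbA⟩ := hB
    exact Fintype.one_lt_card_iff.mpr ⟨a, b, fun h => hbA (h ▸ haA)⟩
  have hnp := not_preconnected_of_separation Γ D A hA hB hAB
  have hκ : vertexConnectivity Γ ≤ D.card := vertexConnectivity_le Γ D (Or.inl hnp)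
  have hlow := card_le_algebraicConnectivity Γ h2 D hD
  refine le_antisymm ((Nat.cast_le.mpr hκ).trans hlow) ?_
  obtain ⟨S, hS, hcut | hone⟩ := Nat.sInf_mem (s := {k : ℕ | ∃ S : Finset V, S.card = k ∧
      (¬ (Γ.induce ((S : Set V)ᶜ)).Preconnected ∨ ((S : Set V)ᶜ).ncard = 1)})
      ⟨_, D, rfl, Or.inl hnp⟩
  · obtain ⟨A', hA', hB', hAB'⟩ := exists_separation_of_not_preconnected Γ S hcut
    have := (algebraicConnectivity_le_card Γ S A' hA' hB' hAB').1
    rwa [hS] at this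
  · exfalso
    have hS' : S.card = vertexConnectivity Γ := hS
    obtain ⟨a, haD, haA⟩ := hA
    obtain ⟨b, hbD, hbA⟩ := hB
    have := vertexConnectivity_add_two_le Γ (u := a) (v := b) (fun h => hbA (h ▸ haA))
      fun hadj => hbA (hAB a haD b hbD hadj haA)
    classical
    rw [← Finset.coe_compl, Set.ncard_coe_finset, Finset.card_compl] at hone
    omega

/-! ### Power graphs of finite cyclic groups -/

/-- The equation `x ^ orderOf u = 1` has at most `orderOf u` solutions, and the powers of `u`
already exhaust them. -/
theorem IsCyclic.mem_zpowers_of_orderOf_dvd {G : Type*} [Group G] [Finite G] [IsCyclic G]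
    {u v : G} (h : orderOf v ∣ orderOf u) : v ∈ Subgroup.zpowers u := by
  classical
  have := Fintype.ofFinite G
  have hle := IsCyclic.card_pow_eq_one_le (α := G) (orderOf_pos u)
  have hsub : (Subgroup.zpowers u : Set G).toFinset ⊆
      Finset.univ.filter fun x : G => x ^ orderOf u = 1 := by
    intro x hx
    rw [Set.mem_toFinset, SetLike.mem_coe] at hx
    rw [Finset.mem_filter]
    exact ⟨Finset.mem_univ _, orderOf_dvd_iff_pow_eq_one.mp (orderOf_dvd_of_mem_zpowers hx)⟩
  have heq := Finset.eq_of_subset_of_card_le hsub (by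
    rw [Set.toFinset_card, ← Nat.card_eq_fintype_card]
    exact hle.trans (Nat.card_zpowers u).ge)
  have hv : v ∈ Finset.univ.filter fun x : G => x ^ orderOf u = 1 := by
    rw [Finset.mem_filter]
    exact ⟨Finset.mem_univ _, orderOf_dvd_iff_pow_eq_one.mp h⟩
  rw [← heq, Set.mem_toFinset] at hv
  exact hv

theorem IsCyclic.exists_orderOf_eq {G : Type*} [Group G] [Finite G] [IsCyclic G] {d : ℕ}
    (hd : d ∣ Nat.card G) : ∃ x : G, orderOf x = d := by
  obtain ⟨g, hg⟩ := IsCyclic.exists_ofOrder_eq_natCard (α := G)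
  obtain ⟨k, hk⟩ := hd
  have hk0 : k ≠ 0 := by
    rintro rfl
    exact Nat.card_pos.ne' (hk.trans (mul_zero d))
  refine ⟨g ^ k, ?_⟩
  rw [orderOf_pow_of_dvd hk0 (by rw [hg, hk]; exact dvd_mul_left _ _), hg, hk,
    Nat.mul_div_cancel _ (Nat.pos_of_ne_zero hk0)]

/-- In a finite cyclic group, adjacency in the power graph is comparability of orders. -/
theorem powerGraph_adj_iff {G : Type*} [Group G] [Finite G] [IsCyclic G] {u v : G} :
    (powerGraph G).Adj u v ↔ u ≠ v ∧ (orderOf v ∣ orderOf u ∨ orderOf u ∣ orderOf v) := by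
  have key : ∀ u v : G, (∃ a : ℕ, 0 < a ∧ v = u ^ a) ↔ orderOf v ∣ orderOf u := by
    intro u v
    constructor
    · rintro ⟨a, -, rfl⟩
      exact orderOf_pow_dvd a
    · intro h
      have hmem := IsCyclic.mem_zpowers_of_orderOf_dvd h
      rw [← mem_powers_iff_mem_zpowers] at hmem
      obtain ⟨k, rfl⟩ := hmem
      -- Adding `orderOf u` keeps the exponent positive when `k = 0`.
      refine ⟨k + orderOf u, by have := orderOf_pos u; omega, ?_⟩
      simp [pow_add, pow_orderOf_eq_one]
  rw [powerGraph, SimpleGraph.fromRel_adj, key, key]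

theorem Nat.Prime.eq_of_pow_dvd_pow {p q k l : ℕ} (hp : p.Prime) (hq : q.Prime) (hk : k ≠ 0)
    (h : p ^ k ∣ q ^ l) : p = q :=
  (Nat.prime_dvd_prime_iff_eq hp hq).mp
    (hp.dvd_of_dvd_pow ((dvd_pow_self p hk).trans h))

/-- If the power graph of a finite cyclic group is the join of a separated part and some `S`, then
`S` omits all elements that are neither trivial nor generators. -/
theorem notMem_of_powerGraph_join {G : Type*} [Group G] [Finite G] [IsCyclic G] {S : Finset G}
    (hS : ∀ i ∈ S, ∀ j ∉ S, (powerGraph G).Adj i j) {a b : G} (ha : a ∉ S) (hb : b ∉ S)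
    (hab : ¬ orderOf a ∣ orderOf b) (hba : ¬ orderOf b ∣ orderOf a) {v : G}
    (hv1 : orderOf v ≠ 1) (hvn : orderOf v ≠ Nat.card G) : v ∉ S := by
  have hinc : ∀ u v : G, u ∉ S → ¬ orderOf u ∣ orderOf v → ¬ orderOf v ∣ orderOf u → v ∉ S := by
    intro u v hu h1 h2 hv
    rcases (powerGraph_adj_iff.mp (hS v hv u hu)).2 with h | h
    · exact h1 h
    · exact h2 h
  rw [Nat.dvd_iff_prime_pow_dvd_dvd] at hab hba
  push Not at hab hba
  obtain ⟨p, k, hp, hpa, hpb⟩ := hab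
  obtain ⟨q, l, hq, hqb, hqa⟩ := hba
  have hk : k ≠ 0 := by
    rintro rfl
    simp at hpb
  have hl : l ≠ 0 := by
    rintro rfl
    simp at hqa
  have hpq : p ≠ q := by
    rintro rfl
    rcases le_total k l with h | h
    · exact hpb ((pow_dvd_pow p h).trans hqb)
    · exact hqa ((pow_dvd_pow p h).trans hpa)
  -- Order `p ^ k` is incomparable with `orderOf b`: it does not divide it, and `q ^ l` divides
  -- `orderOf b` with `q ≠ p`.
  have hgp : ∀ v : G, orderOf v = p ^ k → v ∉ S := fun v hv =>
    hinc b v hb (fun h => hpq (hq.eq_of_pow_dvd_pow hp hl (hqb.trans (hv ▸ h))).symm)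
      (by rwa [hv])
  have hgq : ∀ v : G, orderOf v = q ^ l → v ∉ S := fun v hv =>
    hinc a v ha (fun h => hpq (hp.eq_of_pow_dvd_pow hq hk (hpa.trans (hv ▸ h))))
      (by rwa [hv])
  obtain ⟨x, hx⟩ := IsCyclic.exists_orderOf_eq (G := G) (hpa.trans (orderOf_dvd_natCard a))
  obtain ⟨y, hy⟩ := IsCyclic.exists_orderOf_eq (G := G) (hqb.trans (orderOf_dvd_natCard b))
  have hpow : ∀ (r j : ℕ), r.Prime → j ≠ 0 → ∀ v : G, orderOf v = r ^ j → v ∉ S := by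
    intro r j hr hj v hv
    by_cases hrp : r = p
    · have hrq : r ≠ q := fun h => hpq (hrp.symm.trans h)
      refine hinc y v (hgq y hy) ?_ ?_
      · rw [hy, hv]
        exact fun h => hrq (hq.eq_of_pow_dvd_pow hr hl h).symm
      · rw [hy, hv]
        exact fun h => hrq (hr.eq_of_pow_dvd_pow hq hj h)
    · refine hinc x v (hgp x hx) ?_ ?_
      · rw [hx, hv]
        exact fun h => hrp (hp.eq_of_pow_dvd_pow hr hk h).symm
      · rw [hx, hv]
        exact fun h => hrp (hr.eq_of_pow_dvd_pow hp hj h)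
  -- Some prime power `r ^ j` divides the group order but not `orderOf v`. Either `orderOf v` is
  -- itself a power of `r`, or it is incomparable with `r ^ j`.
  have hnd : ¬ Nat.card G ∣ orderOf v := fun h => hvn (Nat.dvd_antisymm (orderOf_dvd_natCard v) h)
  rw [Nat.dvd_iff_prime_pow_dvd_dvd] at hnd
  push Not at hnd
  obtain ⟨r, j, hr, hrn, hrv⟩ := hnd
  have hj : j ≠ 0 := by
    rintro rfl
    simp at hrv
  by_cases hvr : orderOf v ∣ r ^ j
  · obtain ⟨i, -, hi⟩ := (Nat.dvd_prime_pow hr).mp hvr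
    refine hpow r i hr ?_ v hi
    rintro rfl
    exact hv1 (by simpa using hi)
  · obtain ⟨z, hz⟩ := IsCyclic.exists_orderOf_eq (G := G) hrn
    exact hinc z v (hpow r j hr hj z hz) (by rwa [hz]) (by rwa [hz])

theorem exists_primes_of_powerGraph_join {G : Type*} [Group G] [Finite G] [IsCyclic G]
    {S : Finset G} {A : Set G} (hA : ∃ a ∉ S, a ∈ A) (hB : ∃ b ∉ S, b ∉ A)
    (hAB : ∀ i ∉ S, ∀ j ∉ S, (powerGraph G).Adj i j → i ∈ A → j ∈ A)
    (hS : ∀ i ∈ S, ∀ j ∉ S, (powerGraph G).Adj i j) :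
    ∃ p q : ℕ, p.Prime ∧ q.Prime ∧ p ≠ q ∧ Nat.card G = p * q := by
  obtain ⟨a, haS, haA⟩ := hA
  obtain ⟨b, hbS, hbA⟩ := hB
  -- Comparable orders outside `S` stay on one side of the separation.
  have hcol : ∀ u v : G, u ∉ S → v ∉ S → (orderOf v ∣ orderOf u ∨ orderOf u ∣ orderOf v) →
      u ∈ A → v ∈ A := by
    intro u v hu hv h huA
    by_cases huv : u = v
    · rwa [← huv]
    · exact hAB u hu v hv (powerGraph_adj_iff.mpr ⟨huv, h⟩) huA
  have hab : ¬ orderOf a ∣ orderOf b := fun h => hbA (hcol a b haS hbS (Or.inr h) haA)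
  have hba : ¬ orderOf b ∣ orderOf a := fun h => hbA (hcol a b haS hbS (Or.inl h) haA)
  have hT : ∀ v : G, orderOf v ≠ 1 → orderOf v ≠ Nat.card G → v ∉ S := fun v =>
    notMem_of_powerGraph_join hS haS hbS hab hba
  have ha1 : orderOf a ≠ 1 := fun h => hab (h ▸ one_dvd _)
  have hb1 : orderOf b ≠ 1 := fun h => hba (h ▸ one_dvd _)
  have han : ¬ Nat.card G ∣ orderOf a := fun h => hba ((orderOf_dvd_natCard b).trans h)
  have hbn : ¬ Nat.card G ∣ orderOf b := fun h => hab ((orderOf_dvd_natCard a).trans h)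
  obtain ⟨r, hr, hra⟩ := Nat.exists_prime_and_dvd ha1
  obtain ⟨s, hs, hsb⟩ := Nat.exists_prime_and_dvd hb1
  have hrn := hra.trans (orderOf_dvd_natCard a)
  have hsn := hsb.trans (orderOf_dvd_natCard b)
  obtain ⟨x, hx⟩ := IsCyclic.exists_orderOf_eq (G := G) hrn
  obtain ⟨y, hy⟩ := IsCyclic.exists_orderOf_eq (G := G) hsn
  have hxS : x ∉ S := hT x (hx ▸ hr.ne_one) fun h => han (by rwa [← h, hx])
  have hyS : y ∉ S := hT y (hy ▸ hs.ne_one) fun h => hbn (by rwa [← h, hy])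
  have hxA : x ∈ A := hcol a x haS hxS (Or.inl (hx ▸ hra)) haA
  have hyA : y ∉ A := fun h => hbA (hcol y b hyS hbS (Or.inr (hy ▸ hsb)) h)
  have hrs : r ≠ s := fun h => hyA (hcol x y hxS hyS (Or.inl (by rw [hx, hy, h])) hxA)
  refine ⟨r, s, hr, hs, hrs, ?_⟩
  by_contra hne
  have hdvd : r * s ∣ Nat.card G :=
    Nat.Coprime.mul_dvd_of_dvd_of_dvd ((Nat.coprime_primes hr hs).mpr hrs) hrn hsn
  -- If `r * s` is not the group order, `z` lies outside `S` and joins `x` to `y` across the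
  -- separation.
  obtain ⟨z, hz⟩ := IsCyclic.exists_orderOf_eq (G := G) hdvd
  have hzS : z ∉ S := hT z
    (fun h => hr.ne_one (Nat.dvd_one.mp (h ▸ hz ▸ dvd_mul_right r s)))
    fun h => hne (h.symm.trans hz)
  exact hyA (hcol z y hzS hyS (Or.inl (by rw [hz, hy]; exact dvd_mul_left _ _))
    (hcol x z hxS hzS (Or.inr (by rw [hz, hx]; exact dvd_mul_right _ _)) hxA))

theorem vertexConnectivity_powerGraph_eq_of_card_eq_mul {G : Type*} [Group G] [Fintype G]
    [IsCyclic G] {p q : ℕ} (hp : p.Prime) (hq : q.Prime) (hpq : p ≠ q)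
    (hn : Nat.card G = p * q) :
    (vertexConnectivity (powerGraph G) : ℝ) = algebraicConnectivity (powerGraph G) := by
  classical
  have hpn : p ≠ Nat.card G := by
    rw [hn]
    exact fun h => hq.ne_one (Nat.eq_of_mul_eq_mul_left hp.pos (by rw [← h, mul_one]))
  have hqn : q ≠ Nat.card G := by
    rw [hn]
    exact fun h => hp.ne_one (Nat.eq_of_mul_eq_mul_right hq.pos (by rw [← h, one_mul]))
  have hord : ∀ v : G, orderOf v = 1 ∨ orderOf v = p ∨ orderOf v = q ∨
      orderOf v = Nat.card G := by
    intro v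
    obtain ⟨y, z, hy, hz, hyz⟩ := (Nat.dvd_mul).mp (hn ▸ orderOf_dvd_natCard v)
    rw [← hyz, hn]
    rcases (Nat.dvd_prime hp).mp hy with rfl | rfl <;>
      rcases (Nat.dvd_prime hq).mp hz with rfl | rfl <;> simp
  obtain ⟨x, hx⟩ := IsCyclic.exists_orderOf_eq (G := G) (hn ▸ dvd_mul_right p q)
  obtain ⟨y, hy⟩ := IsCyclic.exists_orderOf_eq (G := G) (hn ▸ dvd_mul_left q p)
  refine vertexConnectivity_eq_of_dominating_cut (powerGraph G)
    (Finset.univ.filter fun v => orderOf v = 1 ∨ orderOf v = Nat.card G) ?_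
    {v | orderOf v = p} ⟨x, ?_, hx⟩ ⟨y, ?_, fun h => hpq (h.symm.trans hy)⟩ ?_
  · intro d hd v hdv
    refine powerGraph_adj_iff.mpr ⟨hdv, ?_⟩
    rcases (Finset.mem_filter.mp hd).2 with h | h
    · exact Or.inr (h ▸ one_dvd _)
    · exact Or.inl (h ▸ orderOf_dvd_natCard v)
  · simp only [Finset.mem_filter, Finset.mem_univ, true_and, hx]
    exact not_or.mpr ⟨hp.ne_one, hpn⟩
  · simp only [Finset.mem_filter, Finset.mem_univ, true_and, hy]
    exact not_or.mpr ⟨hq.ne_one, hqn⟩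
  · intro i _ j hj hadj hi
    simp only [Finset.mem_filter, Finset.mem_univ, true_and, not_or] at hj
    rw [Set.mem_ofPred_eq] at hi ⊢
    rcases hord j with h | h | h | h
    · exact absurd h hj.1
    · exact h
    · have := (powerGraph_adj_iff.mp hadj).2
      rw [hi, h, Nat.prime_dvd_prime_iff_eq hq hp, Nat.prime_dvd_prime_iff_eq hp hq] at this
      exact absurd this (not_or.mpr ⟨hpq.symm, hpq⟩)
    · exact absurd h hj.2

theorem mainTheorem6 (n : ℕ) [NeZero n] (hn : 1 < n) :
    (vertexConnectivity (powerGraph (Multiplicative (ZMod n))) : ℝ) =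
        algebraicConnectivity (powerGraph (Multiplicative (ZMod n))) ↔
      ∃ p q : ℕ, p.Prime ∧ q.Prime ∧ p ≠ q ∧ n = p * q := by
  have hcard : Nat.card (Multiplicative (ZMod n)) = n := Nat.card_zmod n
  constructor
  · intro h
    obtain ⟨S, A, hA, hB, hAB, hS⟩ := exists_join_of_vertexConnectivity_eq _
      (by rwa [← Nat.card_eq_fintype_card, hcard]) h
    simpa only [hcard] using exists_primes_of_powerGraph_join hA hB hAB hS
  · rintro ⟨p, q, hp, hq, hpq, hpqn⟩
    exact vertexConnectivity_powerGraph_eq_of_card_eq_mul hp hq hpq (hcard.trans hpqn)
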